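/- For a scheme $X$ of finite type over $\mathbb Z$ let $[X]$ denote the function $q\mapsto \#X(\mathbb F_q)$ on the set of prime powers $q=p^n$, $n\ge 1$. Let $\mathcal S\subset\mathbb Z[q]$ be the saturated multiplicative system generated by the polynomials $q^n-q$ for $n>1$ (saturated: every divisor in $\mathbb Z[q]$ of an element of $\mathcal S$ is in $\mathcal S$); its elements are regarded as functions on prime powers by evaluation. For a finite set $V$, a partially defined rank function for $V$ is a function $\pi:W\to\mathbb N$, where $W=\operatorname{dom}(\pi)$ is a set of subsets of $V$. For $s\in\mathbb N$ let $L(s,\pi)$ be the scheme over $\mathbb Z$ of all maps $f:V\to\mathbb A^s_{\mathbb Z}$ such that $f|_H$ has rank $\pi(H)$ for every $H\in W$; that is, the locally closed subscheme of $\mathbb A^{V\times s}_{\mathbb Z}=\operatorname{Spec}\mathbb Z[y_{vj}]_{v\in V,\,1\le j\le s}$ on which, for every $H\in W$, all $(\pi(H)+1)\times(\pi(H)+1)$ minors of the matrix $(y_{vj})_{v\in H,\,1\le j\le s}$ vanish and at least one of its $\pi(H)\times\pi(H)$ minors is invertible. For a field $K$, $L(s,\pi)(K)$ is the set of maps $f:V\to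 K^s$ with $\dim\operatorname{span} f(H)=\pi(H)$ for all $H\in W$. Theorem (Mnëv, Sturmfels). Let $X$ be a quasi-projective scheme of finite type over $\mathbb Z$. Then there are a finite set $V$, a partially defined rank function $\pi$ for $V$, and an element $\sigma\in\mathcal S$ such that $$\sigma\,[X]=[L(3,\pi)],$$ that is, $\sigma(q)\cdot\#X(\mathbb F_q)=\#L(3,\pi)(\mathbb F_q)$ for every prime power $q$. -/

import Mathlib

noncomputable section

open AlgebraicGeometry CategoryTheory

namespace MnevSturmfels

/-! ### Point counts -/

/-- The set of prime powers `p ^ n`, `n ≥ 1`. -/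
abbrev PrimePower : Type := {q : ℕ // IsPrimePow q}

instance (q : PrimePower) : Fact (Nat.minFac q.1).Prime :=
  ⟨Nat.minFac_prime q.2.ne_one⟩

/-- The field with `q` elements, for a prime power `q`: the Galois field of order `p ^ n`, where
`p` is the only prime divisor of `q` and `n` its multiplicity. -/
abbrev FF (q : PrimePower) : Type :=
  GaloisField (Nat.minFac q.1) (q.1.factorization (Nat.minFac q.1))

theorem card_FF (q : PrimePower) : Nat.card (FF q) = q.1 := by
  rw [GaloisField.card _ _ ?_, q.2.minFac_pow_factorization_eq]
  intro h
  have := q.2.minFac_pow_factorization_eq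
  rw [h, pow_zero] at this
  exact q.2.ne_one this.symm

/-- The function `[X] : q ↦ #X(𝔽_q)` on prime powers. As `Spec ℤ` is terminal, every morphism
`Spec 𝔽_q ⟶ X` is a morphism over `ℤ`. -/
def pointCount (X : Scheme.{0}) (q : PrimePower) : ℤ :=
  (Nat.card (Spec (.of (FF q)) ⟶ X) : ℤ)

/-- A polynomial in `ℤ[q]`, regarded as a function on prime powers. -/
def polyFun (σ : Polynomial ℤ) (q : PrimePower) : ℤ :=
  σ.eval (q.1 : ℤ)

/-- The saturated multiplicative system in `ℤ[q]` generated by the `q ^ n - q`, `n > 1`. -/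
def calS : SaturatedSubmonoid (Polynomial ℤ) :=
  (Submonoid.closure
    {f : Polynomial ℤ | ∃ n : ℕ, 1 < n ∧ f = Polynomial.X ^ n - Polynomial.X}).saturation

/-! ### Quasi-projective schemes of finite type over `ℤ` -/

/-- Projective `n`-space over `ℤ`, that is `Proj ℤ[x₀, …, xₙ]` with the usual grading. -/
def projectiveSpace (n : ℕ) : Scheme.{0} :=
  letI := MvPolynomial.gradedAlgebra (σ := Fin (n + 1)) (R := ℤ)
  Proj (MvPolynomial.homogeneousSubmodule (Fin (n + 1)) ℤ)

/-- `X` is of finite type over `ℤ`. -/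
def IsFiniteTypeOverInt (X : Scheme.{0}) : Prop :=
  LocallyOfFiniteType (specZIsTerminal.from X) ∧ QuasiCompact (specZIsTerminal.from X)

/-- `X` is quasi-projective over `ℤ`: it is a (locally closed) subscheme of a projective space. -/
def IsQuasiProjectiveOverInt (X : Scheme.{0}) : Prop :=
  ∃ (n : ℕ) (i : X ⟶ projectiveSpace n), IsImmersion i

/-! ### The schemes `L(s, π)` -/

/-- A partially defined rank function for `V`: a set `dom` of subsets of the finite set `V` and a
function `dom → ℕ`. -/
structure PartialRankFunction (V : Type) where
  dom : Finset (Finset V)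
  rank : dom → ℕ

variable {V : Type}

/-- The coordinate ring `ℤ[y_{vj}]` of the affine space `Fun(V, 𝒪^s)` of maps from `V` to affine
`s`-space over `ℤ`. -/
abbrev FunRing (V : Type) (s : ℕ) : Type := MvPolynomial (V × Fin s) ℤ

/-- The universal map from `V` to affine `s`-space, as a matrix of variables whose row `v` is the
image of `v`. -/
def universalMap (V : Type) (s : ℕ) : Matrix V (Fin s) (FunRing V s) :=
  Matrix.of fun v j => MvPolynomial.X (v, j)

/-- The `k × k` minors of the restriction of the universal map to `H`. Rows and columns are chosen
by arbitrary functions: compared with increasing choices, this adds only `0` and sign changes. -/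
def minor (s : ℕ) (H : Finset V) (k : ℕ) (a : Fin k → H) (b : Fin k → Fin s) : FunRing V s :=
  ((universalMap V s).submatrix (fun i => (a i : V)) b).det

/-- The ideal generated, for all `H` in the domain of `π`, by the `(π(H) + 1) × (π(H) + 1)` minors
of the restriction of the universal map to `H`. -/
def rankIdeal (s : ℕ) (π : PartialRankFunction V) : Ideal (FunRing V s) :=
  ⨆ H : π.dom, Ideal.span {m | ∃ a b, m = minor s H.1 (π.rank H + 1) a b}

/-- The closed subscheme of `Fun(V, 𝒪^s)` of the maps whose restriction to each `H` in the domain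
of `π` has rank at most `π(H)`. -/
abbrev LClosed (s : ℕ) (π : PartialRankFunction V) : Scheme.{0} :=
  Spec (.of (FunRing V s ⧸ rankIdeal s π))

/-- The open subset of `LClosed s π` where, for each `H` in the domain of `π`, at least one
`π(H) × π(H)` minor of the restriction to `H` is invertible. -/
def LOpen (s : ℕ) (π : PartialRankFunction V) :
    TopologicalSpace.Opens (PrimeSpectrum (FunRing V s ⧸ rankIdeal s π)) :=
  Finset.univ.inf fun H : π.dom =>
    ⨆ (a : Fin (π.rank H) → H.1) (b : Fin (π.rank H) → Fin s),
      PrimeSpectrum.basicOpen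
        (Ideal.Quotient.mk (rankIdeal s π) (minor s H.1 (π.rank H) a b))

/-- `L(s, π)`: the scheme of all maps from `V` to affine `s`-space over `ℤ` whose restriction to
each `H` in the domain of `π` has rank `π(H)`. It is a locally closed subscheme of `Fun(V, 𝒪^s)`. -/
def L (s : ℕ) (π : PartialRankFunction V) : Scheme.{0} :=
  Scheme.Opens.toScheme (X := LClosed s π) (LOpen s π)

end MnevSturmfels

end

/-! Only field-valued points matter, so `X` may be replaced by anything with the same points over
every field. Cutting `X` into finitely many locally closed affine pieces, and taking the product of
their coordinate rings, gives a ring `B` of finite type whose homomorphisms to `K` are the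
`K`-points (`exists_ring_points`). A presentation of `B` by finitely many polynomials, each broken
up into single additions and multiplications, turns these into the solutions of an elementary system
(`exists_arithSystem`).

Von Staudt's constructions encode this system by collinearities in the projective plane. Relative to
a projective frame, an unknown is a point of the diagonal, horizontal and vertical lines transport
it to the points `(t i, t j)`, an addition is a line of slope one and a multiplication is a line
through the origin (`realizes_std_iff`). Ranks are prescribed only for the triples needed, so
accidental coincidences among the points are harmless and no solution is lost.

By uniqueness of projective coordinates, every realization arises exactly once from a linear
automorphism, a solution, and nonzero scalars at all vertices but `unit` (`exists_normalizing_GL`,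
`exists_std_of_normalized`, `act_std_injective`). With `N` such vertices, each solution thus
contributes `|GL₃(𝔽_q)| (q - 1) ^ N` realizations, a product of divisors of polynomials `q ^ n - q`.
-/

noncomputable section

open AlgebraicGeometry CategoryTheory

namespace MnevSturmfels

/-! ### Points of schemes with values in a field -/

/-- The topological point of a `K`-valued point of a scheme. -/
def pt {K : Type} [Field K] {X : Scheme.{0}} (g : Spec (.of K) ⟶ X) : X :=
  g (⊥ : PrimeSpectrum K)

theorem pt_comp {K : Type} [Field K] {X Y : Scheme.{0}} (g : Spec (.of K) ⟶ X) (f : X ⟶ Y) :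
    pt (g ≫ f) = f (pt g) := rfl

theorem range_eq_singleton_pt {K : Type} [Field K] {X : Scheme.{0}} (g : Spec (.of K) ⟶ X) :
    Set.range g = {pt g} := by
  ext x
  constructor
  · rintro ⟨y, rfl⟩
    exact congrArg g (Subsingleton.elim (α := PrimeSpectrum K) y ⊥)
  · rintro rfl
    exact ⟨_, rfl⟩

/-- Field-valued points of the source of an open immersion are field-valued points of the target
lying in the range. -/
def pointsEquivOfOpenImmersion (K : Type) [Field K] {X Y : Scheme.{0}} (j : Y ⟶ X)
    [IsOpenImmersion j] :
    (Spec (.of K) ⟶ Y) ≃ {g : Spec (.of K) ⟶ X // pt g ∈ j.opensRange} where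
  toFun g := ⟨g ≫ j, by rw [pt_comp]; exact ⟨_, rfl⟩⟩
  invFun g := IsOpenImmersion.lift j g.1 (by
    rw [range_eq_singleton_pt, Set.singleton_subset_iff]; exact g.2)
  left_inv g := (IsOpenImmersion.lift_uniq j _ _ g rfl).symm
  right_inv g := Subtype.ext (IsOpenImmersion.lift_fac j g.1 _)

/-- Field-valued points of an affine scheme are ring homomorphisms. -/
def pointsSpecEquiv (K : Type) [Field K] (A : CommRingCat.{0}) :
    (Spec (.of K) ⟶ Spec A) ≃ (A →+* K) :=
  Spec.homEquiv.trans ⟨fun φ => φ.hom, CommRingCat.ofHom, fun _ => rfl, fun _ => rfl⟩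

theorem pt_pointsSpecEquiv_symm {K : Type} [Field K] (A : CommRingCat.{0}) (φ : A →+* K) :
    pt ((pointsSpecEquiv K A).symm φ) = PrimeSpectrum.comap φ ⊥ := rfl

/-- Homomorphisms from a product ring to a field factor through exactly one of the factors. -/
def prodRingHomEquiv (B C K : Type) [CommRing B] [CommRing C] [Field K] :
    (B →+* K) ⊕ (C →+* K) ≃ (B × C →+* K) :=
  Equiv.ofBijective
    (Sum.elim (fun φ => φ.comp (RingHom.fst B C)) (fun φ => φ.comp (RingHom.snd B C))) (by
      constructor
      · rintro (φ | φ) (ψ | ψ) h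
        · exact congrArg Sum.inl (RingHom.ext fun x => by simpa using congr($h (x, 0)))
        · simpa using congr($h (1, 0))
        · simpa using congr($h (1, 0))
        · exact congrArg Sum.inr (RingHom.ext fun x => by simpa using congr($h (0, x)))
      · intro φ
        have hadd : φ (1, 0) + φ (0, 1) = 1 := by
          rw [← map_add, Prod.mk_add_mk, add_zero, zero_add]; exact map_one φ
        have hmul : φ (1, 0) * φ (0, 1) = 0 := by
          rw [← map_mul, Prod.mk_mul_mk, mul_zero, zero_mul]; exact map_zero φ
        rcases mul_eq_zero.mp hmul with h | h
        · rw [h, zero_add] at hadd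
          refine ⟨.inr ⟨⟨⟨fun c => φ (0, c), hadd⟩, fun c d => ?_⟩, ?_, fun c d => ?_⟩, ?_⟩
          · simp [← map_mul]
          · exact map_zero φ
          · simp [← map_add]
          · ext ⟨b, c⟩
            change φ (0, c) = φ (b, c)
            have : φ (b, c) = φ (b, 0) * φ (1, 0) + φ (0, c) := by simp [← map_mul, ← map_add]
            rw [this, h, mul_zero, zero_add]
        · rw [h, add_zero] at hadd
          refine ⟨.inl ⟨⟨⟨fun c => φ (c, 0), hadd⟩, fun c d => ?_⟩, ?_, fun c d => ?_⟩, ?_⟩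
          · simp [← map_mul]
          · exact map_zero φ
          · simp [← map_add]
          · ext ⟨b, c⟩
            change φ (b, 0) = φ (b, c)
            have : φ (b, c) = φ (b, 0) + φ (0, c) * φ (0, 1) := by simp [← map_mul, ← map_add]
            rw [this, h, mul_zero, add_zero])

/-- Homomorphisms from a quotient ring are homomorphisms killing the ideal. -/
def quotientRingHomEquiv {A K : Type} [CommRing A] [Field K] (I : Ideal A) :
    (A ⧸ I →+* K) ≃ {φ : A →+* K // I ≤ RingHom.ker φ} where
  toFun ψ := ⟨ψ.comp (Ideal.Quotient.mk I), fun a ha => by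
    simp [RingHom.mem_ker, Ideal.Quotient.eq_zero_iff_mem.mpr ha]⟩
  invFun φ := Ideal.Quotient.lift I φ.1 fun _ ha => φ.2 ha
  left_inv ψ := Ideal.Quotient.ringHom_ext (RingHom.ext fun _ => rfl)
  right_inv φ := Subtype.ext (RingHom.ext fun _ => rfl)

theorem quotientRingHomEquiv_apply {A K : Type} [CommRing A] [Field K] (I : Ideal A)
    (ψ : A ⧸ I →+* K) (a : A) :
    (quotientRingHomEquiv I ψ).1 a = ψ (Ideal.Quotient.mk I a) := rfl

theorem finiteType_int_of_isAffineOpen {X : Scheme.{0}} (hft : IsFiniteTypeOverInt X)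
    {U : X.Opens} (hU : IsAffineOpen U) : Algebra.FiniteType ℤ Γ(X, U) := by
  have := hft.1
  have h := Scheme.Hom.finiteType_appLE (specZIsTerminal.from X) (isAffineOpen_top _) hU le_top
  have h2 := RingHom.FiniteType.comp h (RingHom.FiniteType.of_surjective
    ((Scheme.ΓSpecIso (.of ℤ)).inv.hom)
    (ConcreteCategory.bijective_of_isIso (Scheme.ΓSpecIso (.of ℤ)).inv).2)
  rw [RingHom.ext_int (RingHom.comp _ _) (algebraMap ℤ Γ(X, U))] at h2
  exact RingHom.finiteType_algebraMap.mp h2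

/-- The field-valued points of an affine open lying outside another open are the points of an
affine scheme of finite type. -/
theorem exists_ring_points_sdiff {X : Scheme.{0}} (hft : IsFiniteTypeOverInt X)
    {U : X.Opens} (hU : IsAffineOpen U) (W : X.Opens) :
    ∃ (C : Type) (_ : CommRing C), Algebra.FiniteType ℤ C ∧ ∀ (K : Type) [Field K],
      Nonempty ({g : Spec (.of K) ⟶ X // pt g ∈ U ∧ pt g ∉ W} ≃ (C →+* K)) := by
  have := finiteType_int_of_isAffineOpen hft hU
  let Z : Set (PrimeSpectrum Γ(X, U)) := {x | hU.fromSpec x ∉ W}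
  have hZ : IsClosed Z :=
    (hU.fromSpec ⁻¹ᵁ W).isOpen.isClosed_compl
  -- Any ideal cutting out `Z` will do: whether a homomorphism to a field factors through the
  -- quotient depends only on whether its kernel lies in `Z`.
  obtain ⟨I, hI⟩ := (PrimeSpectrum.isClosed_iff_zeroLocus_ideal Z).mp hZ
  refine ⟨Γ(X, U) ⧸ I, inferInstance, .of_surjective (Ideal.Quotient.mk I).toIntAlgHom
    Ideal.Quotient.mk_surjective, fun K _ => ⟨?_⟩⟩
  refine Equiv.trans (Equiv.symm ?_) (quotientRingHomEquiv I).symm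
  let e := (pointsSpecEquiv K Γ(X, U)).symm.trans (pointsEquivOfOpenImmersion K hU.fromSpec)
  refine (e.subtypeEquiv (q := fun g => pt g.1 ∉ W) fun φ => ?_).trans
    ((Equiv.subtypeSubtypeEquivSubtypeInter _ fun g => pt g ∉ W).trans
      (Equiv.subtypeEquivRight fun g => by rw [hU.opensRange_fromSpec]))
  have : pt (e φ).1 = hU.fromSpec (PrimeSpectrum.comap φ ⊥) := by
    change pt (_ ≫ _) = _
    rw [pt_comp, pt_pointsSpecEquiv_symm]
  rw [this]
  change _ ↔ PrimeSpectrum.comap φ ⊥ ∈ Z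
  rw [hI, PrimeSpectrum.mem_zeroLocus]
  rfl

/-- Up to a bijection on field-valued points, every scheme of finite type over `ℤ` is affine of
finite type. -/
theorem exists_ring_points {X : Scheme.{0}} (hft : IsFiniteTypeOverInt X) :
    ∃ (B : Type) (_ : CommRing B), Algebra.FiniteType ℤ B ∧ ∀ (K : Type) [Field K],
      Nonempty ((Spec (.of K) ⟶ X) ≃ (B →+* K)) := by
  suffices ∃ (B : Type) (_ : CommRing B), Algebra.FiniteType ℤ B ∧ ∀ (K : Type) [Field K],
      Nonempty ({g : Spec (.of K) ⟶ X // pt g ∈ (⊤ : X.Opens)} ≃ (B →+* K)) by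
    obtain ⟨B, hB, hB', h⟩ := this
    exact ⟨B, hB, hB', fun K _ => (h K).map fun e =>
      (Equiv.subtypeUnivEquiv fun _ => trivial).symm.trans e⟩
  have hcpt : CompactSpace X := by
    have := hft.2
    exact QuasiCompact.compactSpace_of_compactSpace (specZIsTerminal.from X)
  refine compact_open_induction_on (P := fun W : X.Opens => ∃ (B : Type) (_ : CommRing B),
    Algebra.FiniteType ℤ B ∧ ∀ (K : Type) [Field K],
      Nonempty ({g : Spec (.of K) ⟶ X // pt g ∈ W} ≃ (B →+* K))) ⊤ isCompact_univ ?_ ?_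
  · refine ⟨PUnit, inferInstance, inferInstance, fun K _ => ⟨?_⟩⟩
    have : IsEmpty (PUnit →+* K) :=
      ⟨fun φ => zero_ne_one (α := K) (by rw [← map_zero φ, ← map_one φ])⟩
    have : IsEmpty {g : Spec (.of K) ⟶ X // pt g ∈ (⊥ : X.Opens)} := ⟨fun g => g.2⟩
    exact Equiv.equivOfIsEmpty _ _
  -- The points of `W ∪ U` are those of `W` together with those of `U` outside `W`; the disjoint
  -- union corresponds to a product ring.
  · rintro W - U ⟨B, _, _, hB⟩
    obtain ⟨C, _, _, hC⟩ := exists_ring_points_sdiff hft U.2 W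
    refine ⟨B × C, inferInstance, by convert! Algebra.FiniteType.prod (R := ℤ) (A := B) (B := C), fun K _ => ?_⟩
    obtain ⟨e⟩ := hB K
    obtain ⟨e'⟩ := hC K
    refine ⟨Equiv.trans ?_ ((Equiv.sumCongr e e').trans (prodRingHomEquiv B C K))⟩
    classical
    refine Equiv.trans (Equiv.subtypeEquivRight fun g => ?_)
      (subtypeOrEquiv (fun g => pt g ∈ W) (fun g => pt g ∈ U.1 ∧ pt g ∉ W) ?_)
    · change pt g ∈ W ∨ pt g ∈ U.1 ↔ _
      tauto
    · rw [disjoint_iff]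
      ext g
      simp
      tauto

/-! ### Elementary arithmetic systems -/

/-- A system of equations of the forms `t = 0`, `t = 1`, `t = t' + t''`, `t = t' * t''` in the
unknowns `ι`. -/
structure ArithSystem (ι : Type) where
  zero : ι
  one : ι
  add : ι → ι → ι → Prop
  mul : ι → ι → ι → Prop

/-- `t` solves the arithmetic system `S`. -/
structure ArithSystem.IsSolution {ι : Type} (S : ArithSystem ι) {K : Type} [Field K]
    (t : ι → K) : Prop where
  zero : t S.zero = 0
  one : t S.one = 1
  add : ∀ {i j k}, S.add i j k → t k = t i + t j
  mul : ∀ {i j k}, S.mul i j k → t k = t i * t j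

/-- `t` respects the ring operations of `R` as far as these do not lead out of `J`. -/
structure IsPartialHom {R K : Type} [CommRing R] [Field K] (J : Set R) (t : R → K) : Prop where
  zero : t 0 = 0
  one : t 1 = 1
  add : ∀ {a b}, a ∈ J → b ∈ J → a + b ∈ J → t (a + b) = t a + t b
  mul : ∀ {a b}, a ∈ J → b ∈ J → a * b ∈ J → t (a * b) = t a * t b

theorem IsPartialHom.mono {R K : Type} [CommRing R] [Field K] {J J' : Set R} (h : J ⊆ J')
    {t : R → K} (ht : IsPartialHom J' t) : IsPartialHom J t :=
  ⟨ht.zero, ht.one, fun ha hb hab => ht.add (h ha) (h hb) (h hab),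
    fun ha hb hab => ht.mul (h ha) (h hb) (h hab)⟩

/-- Every partial homomorphism on `J` to a field is given on `J` by polynomial evaluation. -/
def IsRigid {n : Type} (J : Set (MvPolynomial n ℤ)) : Prop :=
  ∀ (K : Type) [Field K] (t : MvPolynomial n ℤ → K), IsPartialHom J t →
    ∀ p ∈ J, t p = MvPolynomial.aeval (fun i => t (MvPolynomial.X i)) p

theorem IsRigid.union {n : Type} {J J' : Set (MvPolynomial n ℤ)} (h : IsRigid J)
    (h' : IsRigid J') : IsRigid (J ∪ J') := by
  rintro K _ t ht p (hp | hp)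
  · exact h K t (ht.mono Set.subset_union_left) p hp
  · exact h' K t (ht.mono Set.subset_union_right) p hp

theorem IsRigid.biUnion {n α : Type} {s : Set α} {J : α → Set (MvPolynomial n ℤ)}
    (h : ∀ a ∈ s, IsRigid (J a)) : IsRigid (⋃ a ∈ s, J a) := by
  intro K _ t ht p hp
  obtain ⟨a, ha, hp⟩ := Set.mem_iUnion₂.mp hp
  exact h a ha K t (ht.mono (Set.subset_biUnion_of_mem ha)) p hp

/-- A polynomial is built from the variables and `0`, `1`, `-1` in finitely many sums and products;
collecting all intermediate results forces its value. -/
theorem exists_finite_isRigid {n : Type} (p : MvPolynomial n ℤ) :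
    ∃ J : Set (MvPolynomial n ℤ), J.Finite ∧ IsRigid J ∧ p ∈ J := by
  have hX (i : n) : ∃ J : Set (MvPolynomial n ℤ), J.Finite ∧ IsRigid J ∧
      MvPolynomial.X i ∈ J := by
    refine ⟨{.X i}, Set.finite_singleton _, ?_, rfl⟩
    rintro K _ t ht p rfl
    simp
  have h0 : ∃ J : Set (MvPolynomial n ℤ), J.Finite ∧ IsRigid J ∧ 0 ∈ J := by
    refine ⟨{0}, Set.finite_singleton _, ?_, rfl⟩
    rintro K _ t ht p rfl
    simp [ht.zero]
  have h1 : ∃ J : Set (MvPolynomial n ℤ), J.Finite ∧ IsRigid J ∧ 1 ∈ J := by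
    refine ⟨{1}, Set.finite_singleton _, ?_, rfl⟩
    rintro K _ t ht p rfl
    simp [ht.one]
  have hadd (p q : MvPolynomial n ℤ) (hp : ∃ J : Set (MvPolynomial n ℤ), J.Finite ∧ IsRigid J ∧
      p ∈ J) (hq : ∃ J : Set (MvPolynomial n ℤ), J.Finite ∧ IsRigid J ∧ q ∈ J) :
      ∃ J : Set (MvPolynomial n ℤ), J.Finite ∧ IsRigid J ∧ p + q ∈ J := by
    obtain ⟨J, hJ, hr, hp⟩ := hp
    obtain ⟨J', hJ', hr', hq⟩ := hq
    refine ⟨insert (p + q) (J ∪ J'), (hJ.union hJ').insert _, ?_, Set.mem_insert _ _⟩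
    intro K _ t ht r hr0
    have hu := (hr.union hr') K t (ht.mono (Set.subset_insert _ _))
    rcases hr0 with rfl | hr0
    · rw [ht.add (by simp [hp]) (by simp [hq]) (by simp), hu p (.inl hp), hu q (.inr hq), map_add]
    · exact hu r hr0
  have hmul (p q : MvPolynomial n ℤ) (hp : ∃ J : Set (MvPolynomial n ℤ), J.Finite ∧ IsRigid J ∧
      p ∈ J) (hq : ∃ J : Set (MvPolynomial n ℤ), J.Finite ∧ IsRigid J ∧ q ∈ J) :
      ∃ J : Set (MvPolynomial n ℤ), J.Finite ∧ IsRigid J ∧ p * q ∈ J := by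
    obtain ⟨J, hJ, hr, hp⟩ := hp
    obtain ⟨J', hJ', hr', hq⟩ := hq
    refine ⟨insert (p * q) (J ∪ J'), (hJ.union hJ').insert _, ?_, Set.mem_insert _ _⟩
    intro K _ t ht r hr0
    have hu := (hr.union hr') K t (ht.mono (Set.subset_insert _ _))
    rcases hr0 with rfl | hr0
    · rw [ht.mul (by simp [hp]) (by simp [hq]) (by simp), hu p (.inl hp), hu q (.inr hq), map_mul]
    · exact hu r hr0
  have hneg : ∃ J : Set (MvPolynomial n ℤ), J.Finite ∧ IsRigid J ∧ -1 ∈ J := by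
    -- The value at `-1` is forced by the relation `1 + (-1) = 0` inside this set.
    refine ⟨{1, -1, 0}, by simp, ?_, by simp⟩
    rintro K _ t ht p (rfl | rfl | rfl)
    · simp [ht.one]
    · have := ht.add (a := 1) (b := -1) (by simp) (by simp) (by simp)
      rw [add_neg_cancel, ht.zero, ht.one] at this
      rw [map_neg, map_one, eq_neg_iff_add_eq_zero, add_comm, ← this]
    · simp [ht.zero]
  induction p using MvPolynomial.induction_on with
  | C a =>
    induction a using Int.induction_on with
    | zero => simpa using h0
    | succ i ih => simpa using hadd _ _ ih h1
    | pred i ih => simpa [sub_eq_add_neg] using hadd _ _ ih hneg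
  | add p q hp hq => exact hadd p q hp hq
  | mul_X p i hp => exact hmul p _ hp (hX i)

/-- The points of an affine scheme of finite type over `ℤ` are the solutions of an elementary
arithmetic system. -/
theorem exists_arithSystem (B : Type) [CommRing B] [Algebra.FiniteType ℤ B] :
    ∃ (ι : Type) (_ : Finite ι) (S : ArithSystem ι), ∀ (K : Type) [Field K],
      Nonempty ({t : ι → K // S.IsSolution t} ≃ (B →+* K)) := by
  obtain ⟨n, f, hf⟩ := Algebra.FiniteType.iff_quotient_mvPolynomial''.mp
    (inferInstance : Algebra.FiniteType ℤ B)
  obtain ⟨G, hG⟩ : (RingHom.ker f).FG := IsNoetherian.noetherian _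
  choose J hfin hrig hmem using exists_finite_isRigid (n := Fin n)
  -- The generators of the kernel make evaluation descend to `B`; the variables make a homomorphism
  -- recoverable from its values.
  let T : Set (MvPolynomial (Fin n) ℤ) := (G : Set _) ∪ Set.range MvPolynomial.X ∪ {0, 1}
  have hT : T.Finite := ((Finset.finite_toSet G).union (Set.finite_range _)).union (by simp)
  let J₀ := ⋃ p ∈ T, J p
  have hJ₀ : J₀.Finite := hT.biUnion fun p _ => hfin p
  have hrig₀ : IsRigid J₀ := IsRigid.biUnion fun p _ => hrig p
  have hsub (p) (hp : p ∈ T) : p ∈ J₀ := Set.mem_biUnion hp (hmem p)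
  have hX (i : Fin n) : .X i ∈ J₀ := hsub _ (by simp [T])
  let I : Set B := f '' J₀
  have hI0 : (0 : B) ∈ I := ⟨0, hsub _ (by simp [T]), map_zero f⟩
  have hI1 : (1 : B) ∈ I := ⟨1, hsub _ (by simp [T]), map_one f⟩
  -- The unknowns are the images in `B`, and the equations are those that hold in `B`. A kernel
  -- generator becomes the unknown `0`, so its vanishing is built in.
  let S : ArithSystem I :=
    ⟨⟨0, hI0⟩, ⟨1, hI1⟩, fun i j k => (i : B) + j = k, fun i j k => (i : B) * j = k⟩
  refine ⟨I, (hJ₀.image f).to_subtype, S, fun K _ => ⟨Equiv.symm (Equiv.ofBijective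
    (fun φ => ⟨fun i => φ i, ⟨map_zero φ, map_one φ, fun {i j k} h => ?_,
      fun {i j k} h => ?_⟩⟩) ⟨fun φ ψ h => ?_, fun t => ?_⟩)⟩⟩
  · rw [← map_add]; exact congrArg φ h.symm
  · rw [← map_mul]; exact congrArg φ h.symm
  · have : (φ.comp f.toRingHom) = ψ.comp f.toRingHom := by
      refine MvPolynomial.ringHom_ext (fun r => ?_) fun i => ?_
      · simp
      · exact congrFun (congrArg Subtype.val h) ⟨f (.X i), _, hX i, rfl⟩
    exact (RingHom.cancel_right hf).mp this
  · obtain ⟨t, ht⟩ := t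
    classical
    -- The default value is never used, since partial homomorphisms are tested only on `J₀`.
    let u : B → K := fun b => if h : b ∈ I then t ⟨b, h⟩ else 0
    have hu (b : B) (h : b ∈ I) : u b = t ⟨b, h⟩ := dif_pos h
    have hpart : IsPartialHom J₀ (u ∘ f) := by
      refine ⟨?_, ?_, fun {a b} ha hb hab => ?_, fun {a b} ha hb hab => ?_⟩
      · simpa [hu _ hI0] using ht.zero
      · simpa [hu _ hI1] using ht.one
      · simp only [Function.comp]
        rw [hu _ ⟨a, ha, rfl⟩, hu _ ⟨b, hb, rfl⟩, hu _ ⟨a + b, hab, rfl⟩]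
        exact ht.add (map_add f a b).symm
      · simp only [Function.comp]
        rw [hu _ ⟨a, ha, rfl⟩, hu _ ⟨b, hb, rfl⟩, hu _ ⟨a * b, hab, rfl⟩]
        exact ht.mul (map_mul f a b).symm
    have hev := hrig₀ K _ hpart
    let ev : MvPolynomial (Fin n) ℤ →+* K :=
      (MvPolynomial.aeval fun i => (u ∘ f) (.X i)).toRingHom
    have hker : RingHom.ker f ≤ RingHom.ker ev := by
      rw [← hG, Submodule.span_le]
      intro g hg
      have h0 : f g = 0 := (hG ▸ Submodule.subset_span hg : g ∈ RingHom.ker f)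
      change MvPolynomial.aeval _ g = 0
      rw [← hev g (hsub g (by simp [T, hg])), Function.comp, h0, hu _ hI0]
      exact ht.zero
    refine ⟨RingHom.liftOfSurjective f.toRingHom hf ⟨ev, hker⟩, Subtype.ext (funext ?_)⟩
    rintro ⟨_, p, hp, rfl⟩
    have := hev p hp
    rw [Function.comp, hu _ ⟨p, hp, rfl⟩] at this
    exact (RingHom.liftOfRightInverse_comp_apply _ _ _ ⟨ev, hker⟩ p).trans this.symm

/-! ### Rank and minors, and the points of `L(s, π)` -/

theorem exists_linearIndependent_comp_of_le_finrank {K M m : Type} [Field K] [AddCommGroup M]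
    [Module K M] [Finite m] (v : m → M) {k : ℕ}
    (hk : k ≤ Module.finrank K (Submodule.span K (Set.range v))) :
    ∃ a : Fin k → m, LinearIndependent K (v ∘ a) := by
  have := Module.Finite.span_of_finite K (Set.finite_range v)
  obtain ⟨w, hw, -, hli⟩ := Submodule.exists_fun_fin_finrank_span_eq K (Set.range v)
  choose a ha using hw
  refine ⟨a ∘ Fin.castLE hk, ?_⟩
  have : v ∘ a ∘ Fin.castLE hk = w ∘ Fin.castLE hk := funext fun i => ha _
  rw [this]
  exact hli.comp _ (Fin.castLE_injective hk)

/-- The rank of a matrix is the largest size of a nonvanishing minor. -/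
theorem exists_det_submatrix_ne_zero_iff {K m n : Type} [Field K] [Finite m] [Fintype n]
    (A : Matrix m n K) (k : ℕ) :
    (∃ (a : Fin k → m) (b : Fin k → n), (A.submatrix a b).det ≠ 0) ↔ k ≤ A.rank := by
  constructor
  · rintro ⟨a, b, h⟩
    have hr := Matrix.rank_of_det_ne_zero h
    have hle := Matrix.eRank_submatrix_le A a b
    rw [Fintype.card_fin] at hr
    rw [← hr, ← Matrix.eRank_toNat_eq_rank, ← Matrix.eRank_toNat_eq_rank]
    refine ENat.toNat_le_toNat hle ?_
    exact ne_top_of_le_ne_top (by simp) A.eRank_le_card_width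
  · intro hk
    rw [Matrix.rank_eq_finrank_span_row] at hk
    obtain ⟨a, ha⟩ := exists_linearIndependent_comp_of_le_finrank A.row hk
    -- The chosen `k` rows are independent, so this submatrix also has `k` independent columns.
    have hr : (A.submatrix a id).rank = k := by
      have := LinearIndependent.rank_matrix (M := A.submatrix a id) ha
      simpa using this
    rw [Matrix.rank_eq_finrank_span_cols] at hr
    obtain ⟨b, hb⟩ := exists_linearIndependent_comp_of_le_finrank (A.submatrix a id).col hr.ge
    refine ⟨a, b, ?_⟩
    have : IsUnit (A.submatrix a b) := Matrix.linearIndependent_cols_iff_isUnit.mp hb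
    exact ((Matrix.isUnit_iff_isUnit_det _).mp this).ne_zero

/-- The rank of the restriction of `f` to `H`. -/
def rk {K V : Type} [Field K] {s : ℕ} (f : V → Fin s → K) (H : Finset V) : ℕ :=
  Module.finrank K (Submodule.span K (f '' H))

theorem rk_eq_rank {K V : Type} [Field K] {s : ℕ} (f : V → Fin s → K) (H : Finset V) :
    rk f H = (Matrix.of fun (v : H) j => f v j).rank := by
  rw [Matrix.rank_eq_finrank_span_row, rk]
  have : Set.range (Matrix.of fun (v : H) j => f v j).row = f '' H := by
    ext x
    exact ⟨fun ⟨v, h⟩ => ⟨v, v.2, h⟩, fun ⟨v, hv, h⟩ => ⟨⟨v, hv⟩, h⟩⟩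
  rw [this]

/-- The maps with the prescribed ranks. -/
def Realizes {K V : Type} [Field K] {s : ℕ} (π : PartialRankFunction V) (f : V → Fin s → K) :
    Prop :=
  ∀ H : π.dom, rk f H.1 = π.rank H

theorem map_minor {K V : Type} [Field K] {s : ℕ} (φ : FunRing V s →+* K) (H : Finset V) (k : ℕ)
    (a : Fin k → H) (b : Fin k → Fin s) :
    φ (minor s H k a b) =
      ((Matrix.of fun (v : H) j => φ (.X ((v : V), j))).submatrix a b).det := by
  rw [minor, RingHom.map_det]
  rfl

theorem rankIdeal_le_ker_iff {K V : Type} [Field K] {s : ℕ} (π : PartialRankFunction V)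
    (φ : FunRing V s →+* K) :
    rankIdeal s π ≤ RingHom.ker φ ↔
      ∀ H : π.dom, rk (fun v j => φ (.X (v, j))) H.1 ≤ π.rank H := by
  rw [rankIdeal, iSup_le_iff]
  refine forall_congr' fun H => ?_
  rw [Ideal.span_le, rk_eq_rank, ← not_lt, ← Nat.add_one_le_iff,
    ← exists_det_submatrix_ne_zero_iff]
  push Not
  constructor
  · intro h a b
    rw [← map_minor]
    exact h ⟨a, b, rfl⟩
  · rintro h _ ⟨a, b, rfl⟩
    change φ _ = 0
    rw [map_minor]
    exact h a b

theorem comap_mem_LOpen_iff {K V : Type} [Field K] {s : ℕ} (π : PartialRankFunction V)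
    (ψ : FunRing V s ⧸ rankIdeal s π →+* K) :
    PrimeSpectrum.comap ψ ⊥ ∈ LOpen s π ↔
      ∀ H : π.dom, π.rank H ≤ rk (fun v j => ψ (Ideal.Quotient.mk _ (.X (v, j)))) H.1 := by
  rw [LOpen, ← SetLike.mem_coe, TopologicalSpace.Opens.coe_finset_inf]
  simp only [Finset.inf_eq_iInf, Finset.mem_univ, iInf_pos, Function.comp,
    Set.iInf_eq_iInter, Set.mem_iInter]
  refine forall_congr' fun H => ?_
  rw [rk_eq_rank, ← exists_det_submatrix_ne_zero_iff]
  simp only [SetLike.mem_coe, TopologicalSpace.Opens.mem_iSup]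
  refine exists_congr fun a => exists_congr fun b => ?_
  have := map_minor (ψ.comp (Ideal.Quotient.mk _)) H.1 _ a b
  simp only [RingHom.comp_apply] at this
  rw [← this]
  exact Iff.rfl

/-- The field-valued points of `L(s, π)` are the maps with the prescribed ranks. -/
theorem card_points_L (K : Type) [Field K] {V : Type} (s : ℕ) (π : PartialRankFunction V) :
    Nat.card (Spec (.of K) ⟶ L s π) = Nat.card {f : V → Fin s → K // Realizes π f} := by
  let U : (LClosed s π).Opens := LOpen s π
  have e₁ : (Spec (.of K) ⟶ L s π) ≃ {g : Spec (.of K) ⟶ LClosed s π // pt g ∈ U} :=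
    (pointsEquivOfOpenImmersion K U.ι).trans
      (Equiv.subtypeEquivRight fun g => by rw [Scheme.Opens.opensRange_ι])
  have e₂ : {g : Spec (.of K) ⟶ LClosed s π // pt g ∈ U} ≃
      {ψ : FunRing V s ⧸ rankIdeal s π →+* K // PrimeSpectrum.comap ψ ⊥ ∈ LOpen s π} :=
    ((pointsSpecEquiv K _).symm.subtypeEquiv fun ψ => Iff.rfl).symm
  have e₃ : {ψ : FunRing V s ⧸ rankIdeal s π →+* K // PrimeSpectrum.comap ψ ⊥ ∈ LOpen s π} ≃
      {φ : FunRing V s →+* K // Realizes π fun v j => φ (.X (v, j))} := by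
    let Q (φ : FunRing V s →+* K) : Prop :=
      ∀ H : π.dom, π.rank H ≤ rk (fun v j => φ (.X (v, j))) H.1
    have d₁ : {ψ : FunRing V s ⧸ rankIdeal s π →+* K // PrimeSpectrum.comap ψ ⊥ ∈ LOpen s π} ≃
        {φ : {φ : FunRing V s →+* K // rankIdeal s π ≤ RingHom.ker φ} // Q φ.1} :=
      (quotientRingHomEquiv (rankIdeal s π)).subtypeEquiv fun ψ => by
        simp only [comap_mem_LOpen_iff, Q, quotientRingHomEquiv_apply]
    refine d₁.trans ((Equiv.subtypeSubtypeEquivSubtypeInter _ Q).trans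
      (Equiv.subtypeEquivRight fun φ => ?_))
    rw [rankIdeal_le_ker_iff, ← forall_and]
    exact forall_congr' fun H => le_antisymm_iff.symm
  have e₄ : {φ : FunRing V s →+* K // Realizes π fun v j => φ (.X (v, j))} ≃
      {f : V → Fin s → K // Realizes π f} := by
    let e : (FunRing V s →+* K) ≃ (V → Fin s → K) :=
      { toFun φ v j := φ (.X (v, j))
        invFun f := MvPolynomial.eval₂Hom (Int.castRingHom K) fun x => f x.1 x.2
        left_inv φ := MvPolynomial.ringHom_ext (by simp) (by simp)
        right_inv f := by ext; simp }
    exact e.subtypeEquiv fun φ => Iff.rfl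
  exact Nat.card_congr (e₁.trans (e₂.trans (e₃.trans e₄)))

/-! ### The configuration of an arithmetic system -/

/-- The points of the projective plane used to encode an arithmetic system in the unknowns `ι`:
the points at infinity of the axes and of the diagonal, the origin `(0, 0)`, the point `(1, 1)` and,
for a solution `t`, the points `(t i, t j)`. -/
inductive Vertex (ι : Type) : Type
  | infX
  | infY
  | origin
  | unit
  | infD
  | point (i j : ι)

open Vertex

instance (ι : Type) [Finite ι] : Finite (Vertex ι) := by
  refine Finite.of_surjective (α := Fin 5 ⊕ ι × ι)
    (Sum.elim ![infX, infY, origin, unit, infD] fun p => point p.1 p.2) ?_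
  rintro (_ | _ | _ | _ | _ | ⟨i, j⟩)
  exacts [⟨.inl 0, rfl⟩, ⟨.inl 1, rfl⟩, ⟨.inl 2, rfl⟩, ⟨.inl 3, rfl⟩, ⟨.inl 4, rfl⟩,
    ⟨.inr (i, j), rfl⟩]

/-- The triples required to be linearly independent. -/
inductive IsFrame {ι : Type} : Vertex ι → Vertex ι → Vertex ι → Prop
  | infX_infY_origin : IsFrame infX infY origin
  | infX_infY_unit : IsFrame infX infY unit
  | infX_origin_unit : IsFrame infX origin unit
  | infY_origin_unit : IsFrame infY origin unit
  | infX_origin_infD : IsFrame infX origin infD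
  | infX_infY_point (i j : ι) : IsFrame infX infY (point i j)

/-- The triples required to span a plane. -/
inductive IsLine {ι : Type} (S : ArithSystem ι) : Vertex ι → Vertex ι → Vertex ι → Prop
  | infinity : IsLine S infX infY infD
  | diagonal_infD : IsLine S origin unit infD
  | diagonal (i : ι) : IsLine S origin unit (point i i)
  | vertical (i j : ι) : IsLine S infY (point i i) (point i j)
  | horizontal (i j : ι) : IsLine S infX (point j j) (point i j)
  | zero : IsLine S infX origin (point S.zero S.zero)
  | one : IsLine S infY unit (point S.one S.one)
  | add {i j k : ι} (h : S.add i j k) : IsLine S infD (point k i) (point j S.zero)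
  | mul {i j k : ι} (h : S.mul i j k) : IsLine S origin (point S.one i) (point j k)

open Classical in
/-- The set of the three given vertices. -/
def triple {V : Type} (u v w : V) : Finset V := {u, v, w}

theorem mem_triple {V : Type} {u v w x : V} : x ∈ triple u v w ↔ x = u ∨ x = v ∨ x = w := by
  simp [triple]

/-- Among the sets whose rank is prescribed, the sets of rank three are recognized by the special
vertices they contain. -/
def IsFrameSet {ι : Type} (H : Finset (Vertex ι)) : Prop :=
  (infX ∈ H ∧ infY ∈ H ∧ infD ∉ H) ∨ ((infX ∈ H ∨ infY ∈ H) ∧ origin ∈ H ∧ unit ∈ H) ∨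
    (infX ∈ H ∧ origin ∈ H ∧ infD ∈ H)

theorem IsFrame.isFrameSet {ι : Type} {u v w : Vertex ι} (h : IsFrame u v w) :
    IsFrameSet (triple u v w) := by
  cases h <;> simp [IsFrameSet, mem_triple]

theorem IsLine.not_isFrameSet {ι : Type} {S : ArithSystem ι} {u v w : Vertex ι}
    (h : IsLine S u v w) : ¬ IsFrameSet (triple u v w) := by
  cases h <;> simp [IsFrameSet, mem_triple]

open Classical in
/-- The partially defined rank function of an arithmetic system. -/
def ArithSystem.rankFunction {ι : Type} [Finite ι] (S : ArithSystem ι) :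
    PartialRankFunction (Vertex ι) where
  dom := letI := Fintype.ofFinite (Vertex ι)
    Finset.univ.filter fun H => ∃ u v w, (IsFrame u v w ∨ IsLine S u v w) ∧ H = triple u v w
  rank H := if IsFrameSet H.1 then 3 else 2

/-- The rank function is attached to sets, not to ordered triples; no set is both a frame and a
line, so the two kinds of condition never conflict. -/
theorem ArithSystem.realizes_rankFunction_iff {ι K : Type} [Finite ι] [Field K]
    (S : ArithSystem ι) {f : Vertex ι → Fin 3 → K} :
    Realizes S.rankFunction f ↔ (∀ u v w, IsFrame u v w → rk f (triple u v w) = 3) ∧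
      ∀ u v w, IsLine S u v w → rk f (triple u v w) = 2 := by
  constructor
  · intro h
    refine ⟨fun u v w hF => ?_, fun u v w hL => ?_⟩
    · have := h ⟨triple u v w, by
        simpa [rankFunction] using ⟨u, v, w, .inl hF, rfl⟩⟩
      simpa [rankFunction, hF.isFrameSet] using this
    · have := h ⟨triple u v w, by
        simpa [rankFunction] using ⟨u, v, w, .inr hL, rfl⟩⟩
      simpa [rankFunction, hL.not_isFrameSet] using this
  · rintro ⟨hF, hL⟩ ⟨H, hH⟩
    obtain ⟨u, v, w, h | h, rfl⟩ : ∃ u v w, (IsFrame u v w ∨ IsLine S u v w) ∧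
        H = triple u v w := by simpa [rankFunction] using hH
    · simpa [rankFunction, h.isFrameSet] using hF u v w h
    · simpa [rankFunction, h.not_isFrameSet] using hL u v w h

/-! ### Ranks of triples of vectors in three-space -/

/-- The determinant of three vectors. -/
def det3 {K : Type} [Field K] (p q r : Fin 3 → K) : K :=
  p 0 * (q 1 * r 2 - q 2 * r 1) - p 1 * (q 0 * r 2 - q 2 * r 0) + p 2 * (q 0 * r 1 - q 1 * r 0)

theorem det_of_eq_det3 {K : Type} [Field K] (p q r : Fin 3 → K) :
    (Matrix.of ![p, q, r]).det = det3 p q r := by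
  rw [Matrix.det_fin_three, det3]
  simp
  ring

theorem rk_triple_eq_rank {K V : Type} [Field K] (f : V → Fin 3 → K) (u v w : V) :
    rk f (triple u v w) = (Matrix.of ![f u, f v, f w]).rank := by
  rw [Matrix.rank_eq_finrank_span_row, rk]
  have : Set.range (Matrix.of ![f u, f v, f w]).row = f '' (triple u v w : Finset V) := by
    change Set.range ![f u, f v, f w] = _
    ext x
    simp [triple, Set.image_insert_eq, or_comm, or_left_comm]
  rw [this]

theorem three_le_rk_triple_iff {K V : Type} [Field K] (f : V → Fin 3 → K) (u v w : V) :
    3 ≤ rk f (triple u v w) ↔ det3 (f u) (f v) (f w) ≠ 0 := by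
  rw [rk_triple_eq_rank, ← det_of_eq_det3]
  constructor
  · intro h
    have h' : (Matrix.of ![f u, f v, f w]).rank = 3 :=
      le_antisymm (by simpa using Matrix.rank_le_card_width (Matrix.of ![f u, f v, f w])) h
    have hli : LinearIndependent K (Matrix.of ![f u, f v, f w]).row := by
      rw [linearIndependent_iff_card_eq_finrank_span, Fintype.card_fin, Set.finrank,
        ← Matrix.rank_eq_finrank_span_row, h']
    exact ((Matrix.isUnit_iff_isUnit_det _).mp
      (Matrix.linearIndependent_rows_iff_isUnit.mp hli)).ne_zero
  · intro h
    simpa using (Matrix.rank_of_det_ne_zero h).ge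

theorem rk_triple_eq_three_iff {K V : Type} [Field K] (f : V → Fin 3 → K) (u v w : V) :
    rk f (triple u v w) = 3 ↔ det3 (f u) (f v) (f w) ≠ 0 := by
  rw [← three_le_rk_triple_iff]
  refine ⟨fun h => h.ge, fun h => le_antisymm ?_ h⟩
  rw [rk_triple_eq_rank]
  simpa using Matrix.rank_le_card_width (Matrix.of ![f u, f v, f w])

theorem det3_eq_zero_of_rk_triple_eq_two {K V : Type} [Field K] {f : V → Fin 3 → K} {u v w : V}
    (h : rk f (triple u v w) = 2) : det3 (f u) (f v) (f w) = 0 := by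
  by_contra h'
  have := (three_le_rk_triple_iff f u v w).mpr h'
  omega

theorem rk_triple_eq_two {K V : Type} [Field K] {f : V → Fin 3 → K} {u v w : V} (i j : Fin 3)
    (hij : f u i * f v j - f u j * f v i ≠ 0) (h : det3 (f u) (f v) (f w) = 0) :
    rk f (triple u v w) = 2 := by
  have h₁ : ¬ 3 ≤ rk f (triple u v w) := by simpa [three_le_rk_triple_iff] using h
  have h₂ : 2 ≤ rk f (triple u v w) := by
    rw [rk_triple_eq_rank, ← exists_det_submatrix_ne_zero_iff]
    exact ⟨![0, 1], ![i, j], by rw [Matrix.det_fin_two]; exact hij⟩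
  omega

/-- The normalized realization attached to a solution. -/
def std {ι K : Type} [Field K] (t : ι → K) : Vertex ι → Fin 3 → K
  | infX => ![1, 0, 0]
  | infY => ![0, 1, 0]
  | origin => ![0, 0, 1]
  | unit => ![1, 1, 1]
  | infD => ![1, 1, 0]
  | point i j => ![t i, t j, 1]

/-- The points `(t k, t i)` and `(t j, 0)` lie on a line of slope one iff `t k = t i + t j`; the
points `(1, t i)` and `(t j, t k)` lie on a line through the origin iff `t k = t i * t j`. For a
solution, the first two vectors of each line are always independent, so its rank is exactly two even
when points coincide. -/
theorem realizes_std_iff {ι K : Type} [Finite ι] [Field K] (S : ArithSystem ι) (t : ι → K) :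
    Realizes S.rankFunction (std t) ↔ S.IsSolution t := by
  rw [S.realizes_rankFunction_iff]
  constructor
  · rintro ⟨-, h⟩
    have h' (u v w) (hL : IsLine S u v w) := det3_eq_zero_of_rk_triple_eq_two (h u v w hL)
    have hz : t S.zero = 0 := by simpa [det3, std] using h' _ _ _ .zero
    have ho : t S.one = 1 := by
      have := h' _ _ _ .one
      simp [det3, std] at this
      linear_combination this
    refine ⟨hz, ho, fun {i j k} hadd => ?_, fun {i j k} hmul => ?_⟩
    · have := h' _ _ _ (.add hadd)
      simp [det3, std, hz] at this
      linear_combination -this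
    · have := h' _ _ _ (.mul hmul)
      simp [det3, std, ho] at this
      linear_combination this
  · intro ht
    refine ⟨fun u v w hF => ?_, fun u v w hL => ?_⟩
    · rw [rk_triple_eq_three_iff]
      cases hF <;> simp [det3, std]
    · cases hL with
      | infinity => exact rk_triple_eq_two 0 1 (by simp [std]) (by simp [det3, std])
      | diagonal_infD => exact rk_triple_eq_two 0 2 (by simp [std]) (by simp [det3, std])
      | diagonal i => exact rk_triple_eq_two 0 2 (by simp [std]) (by simp [det3, std])
      | vertical i j => exact rk_triple_eq_two 1 2 (by simp [std]) (by simp [det3, std])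
      | horizontal i j => exact rk_triple_eq_two 0 2 (by simp [std]) (by simp [det3, std])
      | zero => exact rk_triple_eq_two 0 2 (by simp [std]) (by simp [det3, std, ht.zero])
      | one => exact rk_triple_eq_two 1 2 (by simp [std]) (by simp [det3, std, ht.one])
      | add h =>
        exact rk_triple_eq_two 0 2 (by simp [std]) (by simp [det3, std, ht.zero, ht.add h])
      | mul h =>
        exact rk_triple_eq_two 0 2 (by simp [std, ht.one]) (by
          simp [det3, std, ht.one, ht.mul h])

/-! ### Normalization by linear automorphisms and scalars -/

/-- Scaling the vectors of a configuration and moving it by a linear automorphism. -/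
def act {V K : Type} [Field K] (g : GL (Fin 3) K) (c : V → Kˣ) (f : V → Fin 3 → K) :
    V → Fin 3 → K :=
  fun v => (c v : K) • (g.1.mulVec (f v))

theorem rk_act {V K : Type} [Field K] (g : GL (Fin 3) K) (c : V → Kˣ) (f : V → Fin 3 → K)
    (H : Finset V) : rk (act g c f) H = rk f H := by
  classical
  rw [rk_eq_rank, rk_eq_rank]
  have : (Matrix.of fun (v : H) j => act g c f v j) =
      Matrix.diagonal (fun v : H => (c v : K)) * (Matrix.of fun (v : H) j => f v j) *
        g.1.transpose := by
    ext v j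
    rw [Matrix.mul_assoc, Matrix.diagonal_mul]
    simp only [act, Matrix.of_apply, Pi.smul_apply, smul_eq_mul, Matrix.mulVec, dotProduct,
      Matrix.mul_apply, Matrix.transpose_apply]
    simp only [mul_comm]
  rw [this, Matrix.rank_mul_eq_left_of_isUnit_det, Matrix.rank_mul_eq_right_of_isUnit_det]
  · rw [Matrix.det_diagonal]
    exact (Finset.prod_ne_zero_iff.mpr fun v _ => (c v.1).ne_zero).isUnit
  · rw [Matrix.det_transpose]
    exact (Matrix.isUnit_iff_isUnit_det _).mp g.isUnit

theorem realizes_act_iff {V K : Type} [Field K] (π : PartialRankFunction V) (g : GL (Fin 3) K)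
    (c : V → Kˣ) (f : V → Fin 3 → K) : Realizes π (act g c f) ↔ Realizes π f := by
  simp only [Realizes, rk_act]

/-- A realization whose frame is standard up to scalars is the normalized realization of a
function, up to scalars. -/
theorem exists_std_of_normalized {ι K : Type} [Finite ι] [Field K] {S : ArithSystem ι}
    {h : Vertex ι → Fin 3 → K} (hR : Realizes S.rankFunction h) {a b c : Kˣ}
    (hX : h infX = ![(a : K), 0, 0]) (hY : h infY = ![0, (b : K), 0])
    (hO : h origin = ![0, 0, (c : K)]) (hU : h unit = ![1, 1, 1]) :
    ∃ (t : ι → K) (s : Vertex ι → Kˣ), s unit = 1 ∧ h = fun v => (s v : K) • std t v := by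
  rw [S.realizes_rankFunction_iff] at hR
  obtain ⟨hF, hL⟩ := hR
  have hF' (u v w) (h' : IsFrame u v w) := (rk_triple_eq_three_iff h u v w).mp (hF u v w h')
  have hL' (u v w) (h' : IsLine S u v w) := det3_eq_zero_of_rk_triple_eq_two (hL u v w h')
  -- The two lines through `infD` determine its direction; this frame condition excludes the zero
  -- vector.
  have hD1 : h infD 1 ≠ 0 := by simpa [det3, hX, hO] using hF' _ _ _ .infX_origin_infD
  have hD2 : h infD 2 = 0 := by simpa [det3, hX, hY] using hL' _ _ _ .infinity
  have hD0 : h infD 0 = h infD 1 := by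
    have := hL' _ _ _ .diagonal_infD
    simp [det3, hO, hU] at this
    linear_combination -this
  have hP2 (i j) : h (point i j) 2 ≠ 0 := by
    simpa [det3, hX, hY] using hF' _ _ _ (.infX_infY_point i j)
  have hPd (i) : h (point i i) 0 = h (point i i) 1 := by
    have := hL' _ _ _ (.diagonal i)
    simp [det3, hO, hU] at this
    linear_combination -this
  have hP0 (i j) : h (point i j) 0 * h (point i i) 2 = h (point i j) 2 * h (point i i) 0 := by
    have := hL' _ _ _ (.vertical i j)
    simp [det3, hY] at this
    linear_combination -this
  have hP1 (i j) : h (point i j) 1 * h (point j j) 2 = h (point i j) 2 * h (point j j) 0 := by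
    have := hL' _ _ _ (.horizontal i j)
    simp [det3, hX] at this
    rw [hPd]
    linear_combination -this
  refine ⟨fun i => h (point i i) 0 / h (point i i) 2, fun
    | infX => a
    | infY => b
    | origin => c
    | unit => 1
    | infD => Units.mk0 _ hD1
    | point i j => Units.mk0 _ (hP2 i j), rfl, funext fun v => ?_⟩
  cases v with
  | infX => simp [std, hX]
  | infY => simp [std, hY]
  | origin => simp [std, hO]
  | unit => simp [std, hU]
  | infD => ext k; fin_cases k <;> simp [std, hD0, hD2]
  | point i j =>
    have h₁ := hP2 i i
    have h₂ := hP2 j j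
    ext k
    fin_cases k
    · simp only [std, Units.val_mk0, Fin.zero_eta, Pi.smul_apply, smul_eq_mul,
        Matrix.cons_val_zero]
      rw [mul_div_assoc', eq_div_iff h₁, hP0]
    · simp only [std, Units.val_mk0, Fin.mk_one, Pi.smul_apply, smul_eq_mul,
        Matrix.cons_val_one, Matrix.cons_val_zero]
      rw [mul_div_assoc', eq_div_iff h₂, hP1]
    · simp [std]

/-- Four vectors, any three of which are independent, are carried by a linear automorphism to the
standard frame up to scalars. -/
theorem exists_normalizing_GL {K : Type} [Field K] {x y o u : Fin 3 → K} (h₁ : det3 x y o ≠ 0)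
    (h₂ : det3 x y u ≠ 0) (h₃ : det3 x o u ≠ 0) (h₄ : det3 y o u ≠ 0) :
    ∃ (g : GL (Fin 3) K) (a b c : Kˣ), g.1.mulVec ![(a : K), 0, 0] = x ∧
      g.1.mulVec ![0, (b : K), 0] = y ∧ g.1.mulVec ![0, 0, (c : K)] = o ∧
      g.1.mulVec ![1, 1, 1] = u := by
  -- By Cramer's rule, these are the coefficients of `u` in the basis `x`, `y`, `o`. Scaling the
  -- basis by them sends `![1, 1, 1]` to `u`.
  have hα : det3 y o u / det3 x y o ≠ 0 := div_ne_zero h₄ h₁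
  have hβ : -det3 x o u / det3 x y o ≠ 0 := div_ne_zero (neg_ne_zero.mpr h₃) h₁
  have hγ : det3 x y u / det3 x y o ≠ 0 := div_ne_zero h₂ h₁
  have hu (i : Fin 3) : det3 y o u / det3 x y o * x i + -det3 x o u / det3 x y o * y i +
      det3 x y u / det3 x y o * o i = u i := by
    field_simp
    fin_cases i <;> simp [det3] <;> ring
  generalize det3 y o u / det3 x y o = α at *
  generalize -det3 x o u / det3 x y o = β at *
  generalize det3 x y u / det3 x y o = γ at *
  let A : Matrix (Fin 3) (Fin 3) K := (Matrix.of ![α • x, β • y, γ • o]).transpose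
  have hA : A.det ≠ 0 := by
    have : A.det = α * β * γ * det3 x y o := by
      rw [Matrix.det_transpose, det_of_eq_det3]
      simp [det3]
      ring
    rw [this]
    exact mul_ne_zero (mul_ne_zero (mul_ne_zero hα hβ) hγ) h₁
  have hmul (p q r : K) (i : Fin 3) :
      A.mulVec ![p, q, r] i = α * p * x i + β * q * y i + γ * r * o i := by
    simp [A, Matrix.mulVec, dotProduct, Fin.sum_univ_three]
    ring
  refine ⟨Matrix.GeneralLinearGroup.mkOfDetNeZero A hA, (Units.mk0 α hα)⁻¹, (Units.mk0 β hβ)⁻¹,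
    (Units.mk0 γ hγ)⁻¹, ?_, ?_, ?_, ?_⟩ <;> funext i <;> refine (hmul _ _ _ i).trans ?_
  · simp [hα]
  · simp [hβ]
  · simp [hγ]
  · simpa using hu i

/-- Scalars for all vertices from scalars for the vertices other than the unit point. -/
def extendScalars {ι K : Type} [Field K] (c : {v : Vertex ι // v ≠ unit} → Kˣ) :
    Vertex ι → Kˣ :=
  open Classical in fun v => if h : v = unit then 1 else c ⟨v, h⟩

theorem extendScalars_unit {ι K : Type} [Field K] (c : {v : Vertex ι // v ≠ unit} → Kˣ) :
    extendScalars c unit = 1 := by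
  simp [extendScalars]

theorem extendScalars_of_ne {ι K : Type} [Field K] (c : {v : Vertex ι // v ≠ unit} → Kˣ)
    (v : {v : Vertex ι // v ≠ unit}) : extendScalars c v = c v := by
  simp [extendScalars, v.2]

/-- An automorphism is determined by the lines of the three basis vectors and the image of `![1, 1,
1]`. Fixing the scalar at `unit` removes the ambiguity of a common factor shared between
automorphism and scalars. -/
theorem act_std_injective {ι K : Type} [Field K] {g g' : GL (Fin 3) K} {c c' : Vertex ι → Kˣ}
    {t t' : ι → K} (hc : c unit = 1) (hc' : c' unit = 1)
    (h : act g c (std t) = act g' c' (std t')) : g = g' ∧ c = c' ∧ t = t' := by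
  have hinj (g : GL (Fin 3) K) : Function.Injective g.1.mulVec :=
    Matrix.mulVec_injective_iff_isUnit.mpr g.isUnit
  have hX (i : Fin 3) : (c infX : K) * g.1 i 0 = c' infX * g'.1 i 0 := by
    simpa [act, std, Matrix.mulVec, dotProduct, Fin.sum_univ_three] using
      congrFun (congrFun h infX) i
  have hY (i : Fin 3) : (c infY : K) * g.1 i 1 = c' infY * g'.1 i 1 := by
    simpa [act, std, Matrix.mulVec, dotProduct, Fin.sum_univ_three] using
      congrFun (congrFun h infY) i
  have hO (i : Fin 3) : (c origin : K) * g.1 i 2 = c' origin * g'.1 i 2 := by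
    simpa [act, std, Matrix.mulVec, dotProduct, Fin.sum_univ_three] using
      congrFun (congrFun h origin) i
  have hU (i : Fin 3) : g.1 i 0 + g.1 i 1 + g.1 i 2 = g'.1 i 0 + g'.1 i 1 + g'.1 i 2 := by
    simpa [act, std, Matrix.mulVec, dotProduct, Fin.sum_univ_three, hc, hc'] using
      congrFun (congrFun h unit) i
  -- The columns of `g` are those of `g'` times these ratios, and both matrices have the same sum of
  -- columns. Injectivity of `g'` makes all ratios one.
  have hr : g'.1.mulVec ![(c infX : K)⁻¹ * c' infX, (c infY : K)⁻¹ * c' infY,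
      (c origin : K)⁻¹ * c' origin] = g'.1.mulVec ![1, 1, 1] := by
    ext i
    simp only [Matrix.mulVec, dotProduct, Fin.sum_univ_three, Matrix.cons_val_zero,
      Matrix.cons_val_one, Matrix.cons_val, mul_one]
    rw [← hU, ← inv_mul_cancel_left₀ (c infX).ne_zero (g.1 i 0), hX,
      ← inv_mul_cancel_left₀ (c infY).ne_zero (g.1 i 1), hY,
      ← inv_mul_cancel_left₀ (c origin).ne_zero (g.1 i 2), hO]
    ring
  have hr' := hinj g' hr
  have hcX : (c infX : K) = c' infX := by
    have := congrFun hr' 0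
    simp only [Matrix.cons_val_zero, inv_mul_eq_one₀ (c infX).ne_zero] at this
    exact this
  have hcY : (c infY : K) = c' infY := by
    have := congrFun hr' 1
    simp only [Matrix.cons_val_one, Matrix.cons_val_zero,
      inv_mul_eq_one₀ (c infY).ne_zero] at this
    exact this
  have hcO : (c origin : K) = c' origin := by
    have := congrFun hr' 2
    simp only [Matrix.cons_val, inv_mul_eq_one₀ (c origin).ne_zero] at this
    exact this
  have hg : g = g' := by
    ext i j
    fin_cases j
    · exact mul_left_cancel₀ (c infX).ne_zero ((hX i).trans (by rw [hcX]; rfl))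
    · exact mul_left_cancel₀ (c infY).ne_zero ((hY i).trans (by rw [hcY]; rfl))
    · exact mul_left_cancel₀ (c origin).ne_zero ((hO i).trans (by rw [hcO]; rfl))
  subst hg
  have hstd (v : Vertex ι) : (c v : K) • std t v = (c' v : K) • std t' v := by
    apply hinj g
    rw [Matrix.mulVec_smul, Matrix.mulVec_smul]
    exact congrFun h v
  have hcc : c = c' := by
    funext v
    apply Units.ext
    cases v with
    | infX => exact hcX
    | infY => exact hcY
    | origin => exact hcO
    | unit => rw [hc, hc']
    | infD => simpa [std] using congrFun (hstd infD) 0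
    | point i j => simpa [std] using congrFun (hstd (point i j)) 2
  subst hcc
  refine ⟨rfl, rfl, funext fun i => ?_⟩
  simpa [std] using congrFun (hstd (point i i)) 0

/-- The realizations of the rank function of an arithmetic system are parametrized by the linear
automorphisms, the scalars and the solutions. -/
theorem card_realizes_rankFunction {ι : Type} [Finite ι] (S : ArithSystem ι) (K : Type)
    [Field K] :
    Nat.card {f : Vertex ι → Fin 3 → K // Realizes S.rankFunction f} =
      Nat.card (GL (Fin 3) K) * (Nat.card ({v : Vertex ι // v ≠ unit} → Kˣ) *
        Nat.card {t : ι → K // S.IsSolution t}) := by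
  rw [← Nat.card_prod, ← Nat.card_prod]
  let Φ (p : GL (Fin 3) K × ({v : Vertex ι // v ≠ unit} → Kˣ) × {t : ι → K // S.IsSolution t}) :
      {f : Vertex ι → Fin 3 → K // Realizes S.rankFunction f} :=
    ⟨act p.1 (extendScalars p.2.1) (std p.2.2.1),
      (realizes_act_iff _ _ _ _).mpr ((realizes_std_iff S _).mpr p.2.2.2)⟩
  refine (Nat.card_congr (Equiv.ofBijective Φ ⟨?_, ?_⟩)).symm
  · rintro ⟨g, c, t, ht⟩ ⟨g', c', t', ht'⟩ h
    obtain ⟨rfl, h₂, rfl⟩ := act_std_injective (extendScalars_unit c) (extendScalars_unit c')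
      (congrArg Subtype.val h)
    have : c = c' := funext fun v => by
      rw [← extendScalars_of_ne c, ← extendScalars_of_ne c', h₂]
    rw [this]
  · rintro ⟨f, hf⟩
    have hF (u v w) (h : IsFrame u v w) := (rk_triple_eq_three_iff f u v w).mp
      ((S.realizes_rankFunction_iff.mp hf).1 u v w h)
    obtain ⟨g, a, b, c, hX, hY, hO, hU⟩ := exists_normalizing_GL
      (hF _ _ _ .infX_infY_origin) (hF _ _ _ .infX_infY_unit) (hF _ _ _ .infX_origin_unit)
      (hF _ _ _ .infY_origin_unit)
    have hinv (w : Fin 3 → K) : (g⁻¹).1.mulVec (g.1.mulVec w) = w := by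
      rw [Matrix.mulVec_mulVec, ← Units.val_mul, inv_mul_cancel, Units.val_one, Matrix.one_mulVec]
    have hinv' (w : Fin 3 → K) : g.1.mulVec ((g⁻¹).1.mulVec w) = w := by
      rw [Matrix.mulVec_mulVec, ← Units.val_mul, mul_inv_cancel, Units.val_one, Matrix.one_mulVec]
    have happ (v : Vertex ι) : act g⁻¹ 1 f v = (g⁻¹).1.mulVec (f v) := by simp [act]
    obtain ⟨t, s, hs, h⟩ := exists_std_of_normalized (a := a) (b := b) (c := c)
      ((realizes_act_iff _ g⁻¹ 1 f).mpr hf) (by rw [happ, ← hX, hinv]) (by rw [happ, ← hY, hinv])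
      (by rw [happ, ← hO, hinv]) (by rw [happ, ← hU, hinv])
    have hext : extendScalars (fun v : {v : Vertex ι // v ≠ unit} => s v) = s := by
      funext v
      by_cases hv : v = unit
      · rw [hv, extendScalars_unit, hs]
      · exact extendScalars_of_ne _ ⟨v, hv⟩
    have hact : act g s (std t) = f := by
      funext v
      rw [act, ← Matrix.mulVec_smul, ← congrFun h v, happ, hinv']
    refine ⟨⟨g, fun v => s v, t, ?_⟩, Subtype.ext ?_⟩
    · rw [← realizes_std_iff, ← realizes_act_iff _ g s, hact]
      exact hf
    · change act g (extendScalars _) (std t) = f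
      rw [hext, hact]

/-! ### The factor `σ` -/

theorem X_pow_sub_X_mem_calS {n : ℕ} (hn : 1 < n) :
    (Polynomial.X ^ n - Polynomial.X : Polynomial ℤ) ∈ calS :=
  Submonoid.le_toSubmonoid_saturation (Submonoid.subset_closure ⟨n, hn, rfl⟩)

theorem mem_calS_of_dvd {f g : Polynomial ℤ} (hg : g ∈ calS) (h : f ∣ g) : f ∈ calS := by
  obtain ⟨k, rfl⟩ := h
  exact (calS.mulSaturated hg).1

/-- The number of realizations for each solution, as a polynomial in `q`. -/
def realizationFactor (N : ℕ) : Polynomial ℤ :=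
  (∏ i : Fin 3, (Polynomial.X ^ 3 - Polynomial.X ^ (i : ℕ))) * (Polynomial.X - 1) ^ N

/-- Here `q ^ 3 - 1` divides `q ^ 4 - q`, while `q ^ 3 - q ^ 2 = q (q ^ 2 - q)`, and both `q` and `q
- 1` divide `q ^ 2 - q`. -/
theorem realizationFactor_mem_calS (N : ℕ) : realizationFactor N ∈ calS := by
  have h₂ := X_pow_sub_X_mem_calS (n := 2) (by norm_num)
  have hX : (Polynomial.X : Polynomial ℤ) ∈ calS :=
    mem_calS_of_dvd h₂ ⟨Polynomial.X - 1, by ring⟩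
  have hX1 : (Polynomial.X - 1 : Polynomial ℤ) ∈ calS :=
    mem_calS_of_dvd h₂ ⟨Polynomial.X, by ring⟩
  refine mul_mem (prod_mem fun i _ => ?_) (pow_mem hX1 N)
  fin_cases i
  · exact mem_calS_of_dvd (X_pow_sub_X_mem_calS (n := 4) (by norm_num))
      ⟨Polynomial.X, by simp; ring⟩
  · simpa using X_pow_sub_X_mem_calS (n := 3) (by norm_num)
  · have := mul_mem hX h₂
    convert this using 1
    simp
    ring

theorem polyFun_realizationFactor (N : ℕ) (q : PrimePower) :
    polyFun (realizationFactor N) q =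
      (Nat.card (GL (Fin 3) (FF q)) * Nat.card (FF q)ˣ ^ N : ℕ) := by
  have := Fintype.ofFinite (FF q)
  have hq : Fintype.card (FF q) = q.1 := by rw [← Nat.card_eq_fintype_card, card_FF]
  have h1 : 1 ≤ q.1 := q.2.one_lt.le
  rw [Matrix.card_GL_field, Nat.card_units, card_FF, hq, polyFun, realizationFactor]
  push_cast [Nat.cast_sub h1]
  simp only [Polynomial.eval_mul, Polynomial.eval_prod, Polynomial.eval_sub, Polynomial.eval_pow,
    Polynomial.eval_X, Polynomial.eval_one]
  congr 1
  refine Finset.prod_congr rfl fun i _ => ?_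
  rw [Nat.cast_sub (Nat.pow_le_pow_right h1 i.2.le)]
  push_cast
  rfl

end MnevSturmfels

end

theorem mainTheorem5 (X : AlgebraicGeometry.Scheme.{0})
    (hft : MnevSturmfels.IsFiniteTypeOverInt X)
    (hqp : MnevSturmfels.IsQuasiProjectiveOverInt X) :
    ∃ (V : Type) (_ : Finite V) (π : MnevSturmfels.PartialRankFunction V),
      ∃ σ ∈ MnevSturmfels.calS,
        MnevSturmfels.polyFun σ * MnevSturmfels.pointCount X =
          MnevSturmfels.pointCount (MnevSturmfels.L 3 π) := by
  open MnevSturmfels in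
  -- The ring `B` and the system `S` are chosen before the field, so one `π` and one `σ` serve all
  -- `q`.
  obtain ⟨B, _, _, hB⟩ := exists_ring_points hft
  obtain ⟨ι, _, S, hS⟩ := exists_arithSystem B
  refine ⟨Vertex ι, inferInstance, S.rankFunction,
    realizationFactor (Nat.card {v : Vertex ι // v ≠ .unit}), realizationFactor_mem_calS _,
    funext fun q => ?_⟩
  obtain ⟨e⟩ := hB (FF q)
  obtain ⟨e'⟩ := hS (FF q)
  rw [Pi.mul_apply, polyFun_realizationFactor, pointCount, pointCount, card_points_L,
    card_realizes_rankFunction, Nat.card_congr (e.trans e'.symm), Nat.card_fun, ← mul_assoc,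
    ← Nat.cast_mul]
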